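/- Let $q=p^e$ be a prime power ($p$ prime) and $\mathbb F_q$ the field with $q$ elements. Let $V_n=(\mathbb C^{q})^{\otimes n}$ with orthonormal basis $|x\rangle$, $x\in\mathbb F_q^n$. For $a,b\in\mathbb F_q^n$ and $c\in\mathbb F_p$ let $e=\omega^cX(a)Z(b)$ be the error operator with $X(a)|x\rangle=|x+a\rangle$, $Z(b)|x\rangle=\omega^{\sum_i\mathrm{tr}(b_ix_i)}|x\rangle$, where $\omega=e^{2\pi i/p}$ and $\mathrm{tr}$ is the trace $\mathbb F_q\to\mathbb F_p$; its weight is the number of $i$ with $(a_i,b_i)\ne(0,0)$. An $[[n,k,d]]_q$ quantum code is a subspace $Q\subseteq V_n$ of dimension $q^k$ whose minimum distance is $d$: that is, $d\ge1$ is the largest integer such that $\langle u|e|v\rangle=0$ for all orthogonal $u,v\in Q$ and all error operators $e$ of weight at most $d-1$, where for $\dim Q=1$ one requires in addition that $\langle u|e|v\rangle=0$ for all $u,v\in Q$ and all error operators $e$ of weight between $1$ and $d-1$. It is called a quantum MDS code if it attains the quantum Singleton bound, $2d=n-k+2$. Let $n\le q$, $1\le k_1\le n$ and $1\le k_2\le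 n$ with $k_1+k_2\ge n$. Then: (1) there exists an $[[n,k_1+k_2-n,d]]_q$ quantum code for some $d\ge\min\{n-k_1+1,\,n-k_2+1\}$; (2) when $k_1=k_2=k$ and $k\ge\lceil n/2\rceil$, there exists a quantum MDS code with parameters $[[n,2k-n,n-k+1]]_q$. -/

import Mathlib

namespace QuantumCode

/-- The Hilbert space `V_n = ℂ^q ⊗ ⋯ ⊗ ℂ^q` (`n` factors, `q = |F|`), in coordinates with respect to
its standard orthonormal basis `|c⟩ = |c_1 ⋯ c_n⟩`, `c ∈ F^n`. -/
abbrev QSpace (F : Type*) [Fintype F] (n : ℕ) : Type _ := EuclideanSpace ℂ (Fin n → F)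

/-- The phase `∏ i, ω ^ tr (b_i x_i)`, where `ω = exp (2πi/p)` and `tr` is the trace from `F` to its
prime field. (`ZMod.stdAddChar j = exp (2πi j / p) = ω ^ j`.) -/
noncomputable def phase (p : ℕ) [Fact p.Prime] {F : Type*} [Field F] [Algebra (ZMod p) F]
    {n : ℕ} (b x : Fin n → F) : ℂ :=
  ∏ i, ZMod.stdAddChar (Algebra.trace (ZMod p) F (b i * x i))

/-- `X(a) = X(a_1) ⊗ ⋯ ⊗ X(a_n)`, that is, `X(a)|x⟩ = |x + a⟩`. -/
noncomputable def opX {F : Type*} [Field F] [Fintype F] {n : ℕ} (a : Fin n → F) :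
    QSpace F n →ₗ[ℂ] QSpace F n where
  toFun ψ := WithLp.toLp 2 fun x => ψ (x - a)
  map_add' ψ φ := by ext x; simp
  map_smul' r ψ := by ext x; simp

/-- `Z(b) = Z(b_1) ⊗ ⋯ ⊗ Z(b_n)`, that is, `Z(b)|x⟩ = (∏ i, ω ^ tr (b_i x_i)) |x⟩`. -/
noncomputable def opZ (p : ℕ) [Fact p.Prime] {F : Type*} [Field F] [Fintype F]
    [Algebra (ZMod p) F] {n : ℕ} (b : Fin n → F) : QSpace F n →ₗ[ℂ] QSpace F n where
  toFun ψ := WithLp.toLp 2 fun x => phase p b x * ψ x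
  map_add' ψ φ := by ext x; simp [mul_add]
  map_smul' r ψ := by ext x; simp [mul_left_comm]

theorem opX_single {F : Type*} [Field F] [Fintype F] [DecidableEq F] {n : ℕ} (a x : Fin n → F) :
    opX a (EuclideanSpace.single x (1 : ℂ)) = EuclideanSpace.single (x + a) 1 := by
  ext y
  simp [opX, sub_eq_iff_eq_add]

theorem opZ_single (p : ℕ) [Fact p.Prime] {F : Type*} [Field F] [Fintype F] [DecidableEq F]
    [Algebra (ZMod p) F] {n : ℕ} (b x : Fin n → F) :
    opZ p b (EuclideanSpace.single x (1 : ℂ)) = phase p b x • EuclideanSpace.single x (1 : ℂ) := by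
  ext y
  by_cases h : y = x
  · subst h; simp [opZ]
  · simp [opZ, h]

/-- The element `ω^c X(a) Z(b)` of the error group `G_n`. -/
noncomputable def errorOp {p : ℕ} [Fact p.Prime] {F : Type*} [Field F] [Fintype F]
    [Algebra (ZMod p) F] {n : ℕ} (c : ZMod p) (a b : Fin n → F) :
    QSpace F n →ₗ[ℂ] QSpace F n :=
  ZMod.stdAddChar c • (opX a ∘ₗ opZ p b)

/-- The quantum weight of `ω^c X(a) Z(b)`: the number of `i` with `(a_i, b_i) ≠ (0, 0)`. -/
def qWeight {F : Type*} [Field F] [DecidableEq F] {n : ℕ} (a b : Fin n → F) : ℕ :=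
  hammingNorm fun i => (a i, b i)

/-- `Q` detects `t` errors: `⟨u|e|v⟩ = 0` for all orthogonal `u, v ∈ Q` and all `e` in the error
group of weight at most `t`. -/
def Detects (p : ℕ) [Fact p.Prime] {F : Type*} [Field F] [Fintype F] [DecidableEq F]
    [Algebra (ZMod p) F] {n : ℕ} (Q : Submodule ℂ (QSpace F n)) (t : ℕ) : Prop :=
  ∀ u ∈ Q, ∀ v ∈ Q, inner ℂ u v = 0 → ∀ (c : ZMod p) (a b : Fin n → F),
    qWeight a b ≤ t → inner ℂ u (errorOp c a b v) = 0

/-- Purity up to weight `t`: `⟨u|e|v⟩ = 0` for all `u, v ∈ Q` and all `e` in the error group of weight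
between `1` and `t`. -/
def Pure (p : ℕ) [Fact p.Prime] {F : Type*} [Field F] [Fintype F] [DecidableEq F]
    [Algebra (ZMod p) F] {n : ℕ} (Q : Submodule ℂ (QSpace F n)) (t : ℕ) : Prop :=
  ∀ u ∈ Q, ∀ v ∈ Q, ∀ (c : ZMod p) (a b : Fin n → F),
    1 ≤ qWeight a b → qWeight a b ≤ t → inner ℂ u (errorOp c a b v) = 0

/-- `Q` has dimension `q^k` and detects `d - 1` errors, `d ≥ 1`. For a one-dimensional `Q` detection
is void, and, as usual, purity is required instead. -/
structure IsCode (p : ℕ) [Fact p.Prime] {F : Type*} [Field F] [Fintype F] [DecidableEq F]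
    [Algebra (ZMod p) F] {n : ℕ} (Q : Submodule ℂ (QSpace F n)) (k d : ℕ) : Prop where
  finrank_eq : Module.finrank ℂ Q = Fintype.card F ^ k
  one_le : 1 ≤ d
  detects : Detects p Q (d - 1)
  pure_of_finrank_eq_one : Module.finrank ℂ Q = 1 → Pure p Q (d - 1)

/-- `Q` is an `[[n, k, d]]_q` quantum code whose minimum distance is exactly `d`. -/
def HasParameters (p : ℕ) [Fact p.Prime] {F : Type*} [Field F] [Fintype F] [DecidableEq F]
    [Algebra (ZMod p) F] {n : ℕ} (Q : Submodule ℂ (QSpace F n)) (k d : ℕ) : Prop :=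
  IsGreatest {d' | IsCode p Q k d'} d

/-- `Q` is a quantum MDS code with parameters `[[n, k, d]]_q`: it attains the quantum Singleton
bound, `2d = n - k + 2`. -/
def IsQuantumMDS (p : ℕ) [Fact p.Prime] {F : Type*} [Field F] [Fintype F] [DecidableEq F]
    [Algebra (ZMod p) F] {n : ℕ} (Q : Submodule ℂ (QSpace F n)) (k d : ℕ) : Prop :=
  HasParameters p Q k d ∧ (2 * d : ℤ) = n - k + 2

end QuantumCode

namespace QuantumCode

open Polynomial

/-! ### Additive characters of `F` -/

section Phase

variable (p : ℕ) [Fact p.Prime] {F : Type*} [Field F] [Algebra (ZMod p) F] {n : ℕ}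

/-! The code is a CSS code built from two nested Reed–Solomon codes on the same points, D of
dimension n - k₂ inside C of dimension k₁; n ≤ q supplies distinct points. It is a function space on
C / D, which gives the dimension. An error X(a)Z(b) has zero matrix elements unless a ∈ C and b is
orthogonal to D (`inner_errorOp_eq_zero`). Counting roots, C and the dual of D have minimum weights
at least n - k₁ + 1 and n - k₂ + 1, so the code is pure below the smaller one. Conversely, a
minimum-weight word a of C gives an undetected X(a), so the distance is at most n - k₁ + 1. For k₁ =
k₂ the two bounds meet. -/

theorem phase_eq (b x : Fin n → F) :
    phase p b x = ZMod.stdAddChar (Algebra.trace (ZMod p) F (∑ i, b i * x i)) := by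
  rw [phase, map_sum]
  exact (map_prod (ZMod.stdAddChar (N := p)).toMonoidHom
    (fun i => Multiplicative.ofAdd (Algebra.trace (ZMod p) F (b i * x i))) Finset.univ).symm

theorem phase_add (b x y : Fin n → F) : phase p b (x + y) = phase p b x * phase p b y := by
  simp only [phase, Pi.add_apply, mul_add, map_add, AddChar.map_add_eq_mul, Finset.prod_mul_distrib]

@[simp]
theorem phase_zero_left (x : Fin n → F) : phase p 0 x = 1 := by
  simp [phase]

/-- If the linear code `D` is not orthogonal to `b`, then some phase of `b` on `D` is nontrivial. -/
theorem exists_mem_phase_ne_one [Finite F] {D : Submodule F (Fin n → F)} {b y : Fin n → F}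
    (hy : y ∈ D) (hb : ∑ i, b i * y i ≠ 0) : ∃ z ∈ D, phase p b z ≠ 1 := by
  have : Module.Finite (ZMod p) F := Module.Finite.of_finite
  obtain ⟨t, ht⟩ := Algebra.trace_surjective (ZMod p) F 1
  -- `D` is `F`-linear, so `y` can be rescaled to have pairing `t` of trace 1, hence phase ω.
  refine ⟨(t / ∑ i, b i * y i) • y, D.smul_mem _ hy, ?_⟩
  have hsum : ∑ i, b i * ((t / ∑ i, b i * y i) • y) i = t := by
    simp only [Pi.smul_apply, smul_eq_mul, mul_left_comm (b _), ← Finset.mul_sum]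
    exact div_mul_cancel₀ t hb
  rw [phase_eq, hsum, ht]
  intro h
  exact one_ne_zero (ZMod.injective_stdAddChar (h.trans (AddChar.map_zero_eq_one _).symm))

end Phase

/-! ### Weights of errors -/

section Weight

variable {F : Type*} [Field F] [DecidableEq F] {n : ℕ}

theorem hammingNorm_left_le_qWeight (a b : Fin n → F) : hammingNorm a ≤ qWeight a b :=
  Finset.card_le_card (Finset.monotone_filter_right _ fun _ _ h h0 => h (congrArg Prod.fst h0))

theorem hammingNorm_right_le_qWeight (a b : Fin n → F) : hammingNorm b ≤ qWeight a b :=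
  Finset.card_le_card (Finset.monotone_filter_right _ fun _ _ h h0 => h (congrArg Prod.snd h0))

theorem qWeight_zero_right (a : Fin n → F) : qWeight a 0 = hammingNorm a := by
  simp [qWeight, hammingNorm]

end Weight

/-! ### CSS codes and the errors they detect -/

section CSS

variable {F : Type*} [Field F] [Fintype F] {n : ℕ}

theorem inner_errorOp {p : ℕ} [Fact p.Prime] [Algebra (ZMod p) F] (u v : QSpace F n)
    (c : ZMod p) (a b : Fin n → F) :
    inner ℂ u (errorOp c a b v) =
      ZMod.stdAddChar c * ∑ x, phase p b (x - a) * v (x - a) * starRingEnd ℂ (u x) := by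
  simp [errorOp, PiLp.inner_apply, opX, opZ]

/-- The Calderbank–Shor–Steane code of `D ≤ C`: the vectors supported on `C` and constant on the
cosets of `D`. -/
def cssCode (C D : Submodule F (Fin n → F)) : Submodule ℂ (QSpace F n) where
  carrier := {ψ | (∀ x, x ∉ C → ψ x = 0) ∧ ∀ x, ∀ y ∈ D, ψ (x + y) = ψ x}
  zero_mem' := by simp
  add_mem' := by
    rintro ψ φ ⟨h₁, h₂⟩ ⟨h₃, h₄⟩
    refine ⟨fun x hx => ?_, fun x y hy => ?_⟩
    · simp [h₁ x hx, h₃ x hx]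
    · simp [h₂ x y hy, h₄ x y hy]
  smul_mem' := by
    rintro r ψ ⟨h₁, h₂⟩
    refine ⟨fun x hx => ?_, fun x y hy => ?_⟩
    · simp [h₁ x hx]
    · simp [h₂ x y hy]

theorem mem_cssCode {C D : Submodule F (Fin n → F)} {ψ : QSpace F n} :
    ψ ∈ cssCode C D ↔ (∀ x, x ∉ C → ψ x = 0) ∧ ∀ x, ∀ y ∈ D, ψ (x + y) = ψ x :=
  Iff.rfl

open Classical in
/-- A CSS code is the space of functions on the quotient `C / D`. -/
noncomputable def cssCodeEquiv {C D : Submodule F (Fin n → F)} (h : D ≤ C) :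
    cssCode C D ≃ₗ[ℂ] (C ⧸ D.submoduleOf C → ℂ) where
  toFun ψ s := ψ.1 (Quotient.out s : C)
  map_add' _ _ := rfl
  map_smul' _ _ := rfl
  invFun g := ⟨WithLp.toLp 2 fun x =>
      if hx : x ∈ C then g (Submodule.Quotient.mk ⟨x, hx⟩) else 0, by
    refine mem_cssCode.2 ⟨fun x hx => by simp [hx], fun x y hy => ?_⟩
    by_cases hx : x ∈ C
    · have hxy : x + y ∈ C := C.add_mem hx (h hy)
      simp only [hx, hxy, dif_pos]
      congr 1
      refine (Submodule.Quotient.eq _).2 (Submodule.mem_comap.2 ?_)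
      simpa using hy
    · have hxy : x + y ∉ C := fun hxy => hx ((C.add_mem_iff_left (h hy)).1 hxy)
      simp [hx, hxy]⟩
  left_inv ψ := by
    obtain ⟨ψ, h₁, h₂⟩ := ψ
    refine Subtype.ext (PiLp.ext fun x => ?_)
    by_cases hx : x ∈ C
    · set s : C ⧸ D.submoduleOf C := Submodule.Quotient.mk ⟨x, hx⟩ with hs
      have hmem : ((Quotient.out s : C) : Fin n → F) - x ∈ D := by
        exact Submodule.mem_comap.1 ((Submodule.Quotient.eq (D.submoduleOf C)).1
          ((Quotient.out_eq s : Submodule.Quotient.mk (Quotient.out s) = s).trans hs))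
      have := h₂ x _ hmem
      simp only [hx, dif_pos]
      rw [← this, add_sub_cancel]
    · simp [hx, h₁ x hx]
  right_inv g := by
    funext s
    simp only [SetLike.coe_mem, dif_pos]
    exact congrArg g (Quotient.out_eq s)

theorem finrank_cssCode {C D : Submodule F (Fin n → F)} (h : D ≤ C) :
    Module.finrank ℂ (cssCode C D) =
      Fintype.card F ^ (Module.finrank F C - Module.finrank F D) := by
  classical
  have : Fintype (C ⧸ D.submoduleOf C) := Fintype.ofFinite _
  rw [(cssCodeEquiv h).finrank_eq, Module.finrank_fintype_fun_eq_card,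
    Module.card_eq_pow_finrank (K := F), Submodule.finrank_quotient,
    (Submodule.submoduleOfEquivOfLe h).finrank_eq]

/-- Matrix elements of an error `X(a)Z(b)` between states of a CSS code vanish unless `a ∈ C` and
`b` acts trivially on `D`. -/
theorem inner_errorOp_eq_zero {p : ℕ} [Fact p.Prime] [Algebra (ZMod p) F]
    {C D : Submodule F (Fin n → F)} {u v : QSpace F n} (hu : u ∈ cssCode C D)
    (hv : v ∈ cssCode C D) (c : ZMod p) {a b : Fin n → F}
    (hab : a ∉ C ∨ ∃ z ∈ D, phase p b z ≠ 1) : inner ℂ u (errorOp c a b v) = 0 := by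
  rw [inner_errorOp]
  refine mul_eq_zero_of_right _ ?_
  rcases hab with ha | ⟨z, hz, hbz⟩
  · refine Finset.sum_eq_zero fun x _ => ?_
    by_cases hx : x ∈ C
    · rw [hv.1 (x - a) fun h => ha ((sub_sub_cancel x a) ▸ C.sub_mem hx h)]
      simp
    · simp [hu.1 x hx]
  · set S := ∑ x, phase p b (x - a) * v (x - a) * starRingEnd ℂ (u x) with hS
    -- Translating by `z` fixes `u` and `v` and multiplies every phase by that of `z`.
    have key : S = phase p b z * S := by
      rw [Finset.mul_sum, hS, ← Equiv.sum_comp (Equiv.addRight z)]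
      refine Finset.sum_congr rfl fun x _ => ?_
      simp only [Equiv.coe_addRight, add_sub_right_comm, phase_add, hv.2 _ z hz, hu.2 _ z hz]
      ring
    by_contra hS0
    exact hbz (mul_right_cancel₀ hS0 (by rw [one_mul]; exact key.symm))

open Classical in
/-- The unnormalised coset state `∑_{y ∈ D} |a + y⟩`. -/
noncomputable def cosetState (D : Submodule F (Fin n → F)) (a : Fin n → F) : QSpace F n :=
  WithLp.toLp 2 fun x => if x - a ∈ D then 1 else 0

theorem cosetState_mem {C D : Submodule F (Fin n → F)} (h : D ≤ C) {a : Fin n → F} (ha : a ∈ C) :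
    cosetState D a ∈ cssCode C D := by
  refine mem_cssCode.2 ⟨fun x hx => ?_, fun x y hy => ?_⟩
  · exact if_neg fun hxa => hx ((C.sub_mem_iff_left ha).1 (h hxa))
  · have : x + y - a ∈ D ↔ x - a ∈ D := by rw [add_sub_right_comm, D.add_mem_iff_left hy]
    classical exact if_congr this rfl rfl

theorem inner_cosetState_zero {D : Submodule F (Fin n → F)} {a : Fin n → F} (ha : a ∉ D) :
    inner ℂ (cosetState D a) (cosetState D 0) = 0 := by
  rw [PiLp.inner_apply]
  refine Finset.sum_eq_zero fun x _ => ?_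
  by_cases hx : x ∈ D
  · have : x - a ∉ D := fun h => ha ((sub_sub_cancel x a) ▸ D.sub_mem hx h)
    simp [cosetState, this]
  · simp [cosetState, hx]

/-- X(a) carries the state of D to that of a + D, so this is a squared norm. -/
theorem inner_cosetState_errorOp_ne_zero {p : ℕ} [Fact p.Prime] [Algebra (ZMod p) F]
    (D : Submodule F (Fin n → F)) (a : Fin n → F) :
    inner ℂ (cosetState D a) (errorOp (0 : ZMod p) a 0 (cosetState D 0)) ≠ 0 := by
  have h : errorOp (0 : ZMod p) a 0 (cosetState D 0) = cosetState D a := by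
    ext x
    simp only [errorOp, opX, opZ, cosetState]
    simp only [AddChar.map_zero_eq_one, one_smul, LinearMap.comp_apply, LinearMap.coe_mk,
      AddHom.coe_mk, phase_zero_left, one_mul]
    classical exact if_congr (by rw [sub_zero]) rfl rfl
  rw [h, inner_self_ne_zero]
  intro h0
  have := congrArg (fun ψ : QSpace F n => ψ a) h0
  simp [cosetState] at this

variable [DecidableEq F]

variable (p : ℕ) [Fact p.Prime] [Algebra (ZMod p) F]

/-- A CSS code is pure, and detects errors, up to weight `t`, if `C` has no nonzero word of weight at
most `t` and neither does the dual of `D`. -/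
theorem cssCode_pure {C D : Submodule F (Fin n → F)} {t : ℕ}
    (hC : ∀ a ∈ C, hammingNorm a ≤ t → a = 0)
    (hD : ∀ b : Fin n → F, (∀ y ∈ D, ∑ i, b i * y i = 0) → hammingNorm b ≤ t → b = 0) :
    Pure p (cssCode C D) t := by
  intro u hu v hv c a b h1 ht
  refine inner_errorOp_eq_zero hu hv c ?_
  by_contra! hab
  have ha := hC a hab.1 ((hammingNorm_left_le_qWeight a b).trans ht)
  have hb := hD b (fun y hy => by
    by_contra hne
    obtain ⟨z, hz, hbz⟩ := exists_mem_phase_ne_one p hy hne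
    exact hbz (hab.2 z hz)) ((hammingNorm_right_le_qWeight a b).trans ht)
  subst ha hb
  rw [qWeight_zero_right, hammingNorm_zero] at h1
  exact absurd h1 (by norm_num)

/-- Purity leaves only weight 0, where the error is a scalar and preserves orthogonality. -/
theorem Pure.detects {Q : Submodule ℂ (QSpace F n)} {t : ℕ} (h : Pure p Q t) : Detects p Q t := by
  intro u hu v hv huv c a b ht
  rcases Nat.eq_zero_or_pos (qWeight a b) with h0 | hpos
  · have ha : a = 0 := hammingNorm_eq_zero.1
      (Nat.le_zero.1 (h0 ▸ hammingNorm_left_le_qWeight a b))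
    have hb : b = 0 := hammingNorm_eq_zero.1
      (Nat.le_zero.1 (h0 ▸ hammingNorm_right_le_qWeight a b))
    subst ha hb
    have hid : errorOp c (0 : Fin n → F) 0 v = ZMod.stdAddChar c • v := by
      ext x
      simp [errorOp, opX, opZ]
    rw [hid, inner_smul_right, huv, mul_zero]
  · exact h u hu v hv c a b hpos ht

/-- A word `a ∈ C` bounds the minimum distance of a CSS code if it is not in `D`, or if the code is
one-dimensional. -/
theorem IsCode.le_hammingNorm {C D : Submodule F (Fin n → F)} (h : D ≤ C) {a : Fin n → F}
    (ha : a ∈ C) (ha0 : a ≠ 0) (haD : a ∉ D ∨ Module.finrank ℂ (cssCode C D) = 1) {k d : ℕ}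
    (hQ : IsCode p (cssCode C D) k d) : d ≤ hammingNorm a := by
  by_contra! hd
  have hw : qWeight a 0 ≤ d - 1 := by rw [qWeight_zero_right]; omega
  have hu := cosetState_mem h ha
  have hv := cosetState_mem h C.zero_mem
  refine inner_cosetState_errorOp_ne_zero (p := p) D a ?_
  rcases haD with haD | h1
  · exact hQ.detects _ hu _ hv (inner_cosetState_zero haD) 0 a 0 hw
  · refine hQ.pure_of_finrank_eq_one h1 _ hu _ hv 0 a 0 ?_ hw
    rw [qWeight_zero_right]
    exact hammingNorm_pos_iff.2 ha0

end CSS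

/-! ### Reed–Solomon codes and their weights -/

section ReedSolomon

variable {F : Type*} [Field F] {n : ℕ}

/-- Evaluation of polynomials at the points `α i`. -/
noncomputable def evalPoints (α : Fin n → F) : F[X] →ₗ[F] (Fin n → F) :=
  LinearMap.pi fun i => Polynomial.leval (α i)

@[simp]
theorem evalPoints_apply (α : Fin n → F) (f : F[X]) (i : Fin n) :
    evalPoints α f i = f.eval (α i) := rfl

/-- The Reed–Solomon code of the evaluations of polynomials of degree less than `k`. -/
noncomputable def reedSolomon (α : Fin n → F) (k : ℕ) : Submodule F (Fin n → F) :=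
  (degreeLT F k).map (evalPoints α)

theorem reedSolomon_mono (α : Fin n → F) {k l : ℕ} (h : k ≤ l) :
    reedSolomon α k ≤ reedSolomon α l :=
  Submodule.map_mono (degreeLT_mono h)

variable {α : Fin n → F}

theorem eq_zero_of_evalPoints_eq_zero (hα : Function.Injective α) {f : F[X]} (hf : f ∈ degreeLT F n)
    (h : evalPoints α f = 0) : f = 0 := by
  classical
  refine eq_zero_of_degree_lt_of_eval_index_eq_zero Finset.univ hα.injOn ?_ ?_
  · simpa using mem_degreeLT.1 hf
  · exact fun i _ => congrFun h i

theorem finrank_reedSolomon (hα : Function.Injective α)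
    {k : ℕ} (hk : k ≤ n) : Module.finrank F (reedSolomon α k) = k := by
  have hinj : Function.Injective ((evalPoints α).domRestrict (degreeLT F k)) := by
    rw [← LinearMap.ker_eq_bot, LinearMap.ker_eq_bot']
    exact fun f hf => Subtype.ext (eq_zero_of_evalPoints_eq_zero hα (degreeLT_mono hk f.2) hf)
  rw [reedSolomon, ← LinearMap.range_domRestrict, LinearMap.finrank_range_of_inj hinj,
    (degreeLTEquiv F k).finrank_eq, Module.finrank_fin_fun]

theorem prod_X_sub_C_mem_degreeLT {s : Finset (Fin n)} {k : ℕ} (hs : s.card < k) :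
    ∏ j ∈ s, (X - C (α j)) ∈ degreeLT F k := by
  rw [mem_degreeLT, degree_prod_of_monic _ _ fun j _ => monic_X_sub_C _]
  simpa using hs

theorem evalPoints_prod_X_sub_C_eq_zero_iff (hα : Function.Injective α)
    {s : Finset (Fin n)} {i : Fin n} :
    evalPoints α (∏ j ∈ s, (X - C (α j))) i = 0 ↔ i ∈ s := by
  simp [eval_prod, Finset.prod_eq_zero_iff, sub_eq_zero, hα.eq_iff]

/-- The dual of a Reed–Solomon code of dimension `k` has no nonzero word of weight at most `k`. -/
theorem eq_zero_of_orthogonal_reedSolomon [DecidableEq F] (hα : Function.Injective α)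
    {k : ℕ} {b : Fin n → F}
    (hb : ∀ y ∈ reedSolomon α k, ∑ i, b i * y i = 0) (hw : hammingNorm b ≤ k) : b = 0 := by
  by_contra hb0
  obtain ⟨i, hi⟩ := Function.ne_iff.1 hb0
  set s : Finset (Fin n) := Finset.univ.filter fun j => b j ≠ 0 with hs
  have his : i ∈ s := by simpa [hs] using hi
  have hcard : (s.erase i).card < k := (Finset.card_erase_lt_of_mem his).trans_le hw
  -- The polynomial vanishing on the support of `b` except at `i` reduces the pairing to its `i`-th
  -- term.
  have h := hb _ ⟨_, prod_X_sub_C_mem_degreeLT (α := α) hcard, rfl⟩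
  rw [Finset.sum_eq_single i] at h
  · rcases mul_eq_zero.1 h with h | h
    · exact hi h
    · exact Finset.notMem_erase i s ((evalPoints_prod_X_sub_C_eq_zero_iff hα).1 h)
  · intro j _ hj
    by_cases hbj : b j = 0
    · rw [hbj, zero_mul]
    · rw [(evalPoints_prod_X_sub_C_eq_zero_iff hα).2, mul_zero]
      exact Finset.mem_erase.2 ⟨hj, by simpa [hs] using hbj⟩
  · exact fun h => absurd (Finset.mem_univ i) h

/-- A nonzero word of a Reed–Solomon code of dimension `k` has weight more than `n - k`. -/
theorem eq_zero_of_mem_reedSolomon [DecidableEq F] (hα : Function.Injective α)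
    {k : ℕ} (hk : k ≤ n)
    {a : Fin n → F} (ha : a ∈ reedSolomon α k) (hw : hammingNorm a ≤ n - k) : a = 0 := by
  obtain ⟨f, hf, rfl⟩ := ha
  have hcard := Finset.card_filter_add_card_filter_not (s := (Finset.univ : Finset (Fin n)))
    fun i => evalPoints α f i ≠ 0
  rw [Finset.card_univ, Fintype.card_fin] at hcard
  change hammingNorm (evalPoints α f) + _ = n at hcard
  -- Weight at most n - k leaves at least k roots, while the degree is below k.
  have hf0 : f = 0 := by
    refine eq_zero_of_degree_lt_of_eval_index_eq_zero (Finset.univ.filter fun i =>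
      ¬ evalPoints α f i ≠ 0) hα.injOn ?_ ?_
    · refine (mem_degreeLT.1 hf).trans_le (Nat.cast_le.2 ?_)
      omega
    · intro i hi
      simpa using hi
  rw [hf0, map_zero]

/-- A Reed–Solomon code of dimension `k` has a word of weight `n - k + 1` that is in no smaller
Reed–Solomon code. -/
theorem exists_mem_reedSolomon_hammingNorm_eq [DecidableEq F] (hα : Function.Injective α)
    {k : ℕ} (hk1 : 1 ≤ k) (hk : k ≤ n) :
    ∃ a ∈ reedSolomon α k, a ≠ 0 ∧ hammingNorm a = n - k + 1 ∧
      ∀ l < k, a ∉ reedSolomon α l := by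
  obtain ⟨s, -, hs⟩ := Finset.exists_subset_card_eq
    (s := (Finset.univ : Finset (Fin n))) (n := k - 1) (by simp; omega)
  -- Degree exactly k - 1, with all its roots among the points.
  set f : F[X] := ∏ j ∈ s, (X - C (α j)) with hf
  have hfk : f ∈ degreeLT F k := prod_X_sub_C_mem_degreeLT (by omega)
  have hnorm : hammingNorm (evalPoints α f) = n - k + 1 := by
    have : (Finset.univ.filter fun i => evalPoints α f i ≠ 0) = sᶜ := by
      ext i
      simp only [Finset.mem_filter, Finset.mem_univ, true_and, Finset.mem_compl, Ne, hf,
        evalPoints_prod_X_sub_C_eq_zero_iff hα]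
    rw [hammingNorm, this, Finset.card_compl, Fintype.card_fin, hs]
    omega
  refine ⟨evalPoints α f, ⟨f, hfk, rfl⟩, ?_, hnorm, ?_⟩
  · rw [← hammingNorm_pos_iff, hnorm]
    omega
  · rintro l hl ⟨g, hg, hgf⟩
    have hgf' : g = f := sub_eq_zero.1 <| eq_zero_of_evalPoints_eq_zero hα
      ((degreeLT F n).sub_mem (degreeLT_mono (hl.le.trans hk) hg) (degreeLT_mono hk hfk))
      (by rw [map_sub, hgf, sub_self])
    have hdeg : f.degree < (l : WithBot ℕ) := mem_degreeLT.1 (hgf' ▸ hg)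
    rw [hf, degree_prod_of_monic _ _ fun j _ => monic_X_sub_C _] at hdeg
    simp only [degree_X_sub_C, Finset.sum_const, hs, nsmul_eq_mul, mul_one] at hdeg
    have : k - 1 < l := by exact_mod_cast hdeg
    omega

end ReedSolomon

/-! ### Parameters of the CSS code of two Reed–Solomon codes -/

section RSCode

variable {p : ℕ} [Fact p.Prime] {F : Type*} [Field F] [Fintype F] [DecidableEq F]
  [Algebra (ZMod p) F] {n k₁ k₂ : ℕ} {α : Fin n → F}

theorem isCode_cssCode_reedSolomon (hα : Function.Injective α) (hk₁n : k₁ ≤ n)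
    (hk₂n : k₂ ≤ n) (hk : n ≤ k₁ + k₂) :
    IsCode p (cssCode (reedSolomon α k₁) (reedSolomon α (n - k₂))) (k₁ + k₂ - n)
      (min (n - k₁ + 1) (n - k₂ + 1)) := by
  have hpure : Pure p (cssCode (reedSolomon α k₁) (reedSolomon α (n - k₂)))
      (min (n - k₁ + 1) (n - k₂ + 1) - 1) := by
    refine cssCode_pure p (fun a ha hw => ?_) (fun b hb hw => ?_)
    · exact eq_zero_of_mem_reedSolomon hα hk₁n ha (by omega)
    · exact eq_zero_of_orthogonal_reedSolomon hα hb (by omega)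
  refine ⟨?_, by omega, hpure.detects, fun _ => hpure⟩
  rw [finrank_cssCode (reedSolomon_mono α (by omega)), finrank_reedSolomon hα hk₁n,
    finrank_reedSolomon hα (by omega)]
  congr 1
  omega

theorem le_of_isCode_cssCode_reedSolomon (hα : Function.Injective α) (hk₁ : 1 ≤ k₁)
    (hk₁n : k₁ ≤ n) (hk : n ≤ k₁ + k₂) {k d : ℕ}
    (h : IsCode p (cssCode (reedSolomon α k₁) (reedSolomon α (n - k₂))) k d) :
    d ≤ n - k₁ + 1 := by
  have hle : n - k₂ ≤ k₁ := by omega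
  obtain ⟨a, ha, ha0, hw, hmem⟩ := exists_mem_reedSolomon_hammingNorm_eq hα hk₁ hk₁n
  rw [← hw]
  refine h.le_hammingNorm p (reedSolomon_mono α hle) ha ha0 ?_
  -- If n - k₂ = k₁ then C = D: the code is one-dimensional, and purity is what fails.
  rcases hle.lt_or_eq with hlt | heq
  · exact Or.inl (hmem _ hlt)
  · refine Or.inr ?_
    rw [finrank_cssCode (reedSolomon_mono α hle), heq, Nat.sub_self, pow_zero]

end RSCode

end QuantumCode

theorem theorem3p7 {p : ℕ} [Fact p.Prime] {F : Type*} [Field F] [Fintype F] [DecidableEq F]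
    [Algebra (ZMod p) F] (n k₁ k₂ : ℕ) (hn : n ≤ Fintype.card F)
    (hk₁ : 1 ≤ k₁) (hk₁n : k₁ ≤ n) (hk₂ : 1 ≤ k₂) (hk₂n : k₂ ≤ n) (hk : n ≤ k₁ + k₂) :
    (∃ (Q : Submodule ℂ (QuantumCode.QSpace F n)) (d : ℕ),
      QuantumCode.HasParameters p Q (k₁ + k₂ - n) d ∧ min (n - k₁ + 1) (n - k₂ + 1) ≤ d) ∧
    (∀ k : ℕ, k₁ = k → k₂ = k → ⌈(n : ℚ) / 2⌉₊ ≤ k →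
      ∃ Q : Submodule ℂ (QuantumCode.QSpace F n),
        QuantumCode.IsQuantumMDS p Q (2 * k - n) (n - k + 1)) := by
  obtain ⟨α⟩ : Nonempty (Fin n ↪ F) := Function.Embedding.nonempty_of_card_le (by simpa using hn)
  have hcode := QuantumCode.isCode_cssCode_reedSolomon (p := p) α.injective hk₁n hk₂n hk
  have hbound : ∀ d, QuantumCode.IsCode p _ (k₁ + k₂ - n) d → d ≤ n - k₁ + 1 := fun d h =>
    QuantumCode.le_of_isCode_cssCode_reedSolomon α.injective hk₁ hk₁n hk h
  refine ⟨?_, ?_⟩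
  -- Only boundedness is needed: the exact distance need not be identified here.
  · obtain ⟨d, hd⟩ := BddAbove.exists_isGreatest_of_nonempty ⟨_, hbound⟩ ⟨_, hcode⟩
    exact ⟨_, d, hd, hd.2 hcode⟩
  · rintro k rfl rfl -
    rw [min_self] at hcode
    rw [← two_mul] at hcode hbound hk
    refine ⟨_, ⟨hcode, hbound⟩, ?_⟩
    push_cast [hk₁n, hk]
    ring
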